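/- **Setting.** A kernel is a $K$-level nested loop (level $1$ is innermost) with one vertex for each variable instance: its single-static-assignment multilevel graph. Each vertex has a data type (index, number, boolean, or array with indices in $\mathbb Z^r$), an operation with ordered operands, a level, and the numbers of the invocation and of the iteration of its loop to which it belongs. The operations are: input symbol, loop counter (begin, end, step), scalar operations, reading (get) and writing (set) an array element, $\varphi$ functions (the value on the path whose condition holds), and calls of the next inner loop. The level-$k$ loop has a fixed finite number $N_k$ of iterations. The kernel is a *$d$-dimensional $m$-point stencil computation* if it can be executed on at least one input and, for fixed scalar inputs, there are finitely many disjoint regions of $\mathbb Z^d$ on each of which its output array is $$B[\mathbf x]=\lambda_1A[t_1(\mathbf x)]+\dots+\lambda_mA[t_m(\mathbf x)]$$ with scalars $\lambda_j$ and affine maps $t_j$ (depending on the region), while $B$ keeps its initial values elsewhere. An *invariant subgraph* of the level-$k$ loop is a finite graph $H$ with operations such that most iteration slices of the loop are in bijection with $H$, where the bijections respect the operations ($\varphi$ functions may be extended) and send dependencies within an iteration, and between iterations of one invocation, to edges of $H$. A *summary* of a vertex is a list of branches (condition $\to$ expression), whose conditions and expressions depend on the input symbols, the iteration variable $t$ and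 the position $\mathbf x$ (scalars have one position). The summary of a vertex is computed from the summaries of its operands by the rule of its operation. Let $C$ be a strongly connected component (SCC) of $H$. Suppose given mutually exclusive and exhaustive summaries of all vertices outside $C$; postconditions (mutually exclusive branches, the output variable keeping its initial value where none applies) for the inner-loop calls; a start vertex $v\in C$; an initial summary $\hat S(\mathbf x)$ of $v$ which, if $C$ contains an edge, is the known summary, independent of $t$, of a predecessor of $v$ outside $C$ of the same type; and an order of the other vertices of $C$ in which every vertex comes after its predecessors in $C$ other than $v$. The *iterative semantic extraction* runs as follows. 1. Initialize $S(v)$ by $\hat S$ and perform a *forward sweep*: apply the summary rules along the given order, and at $v$ last. After a sweep, $S(v)$ consists of update branches $(E_j(\mathbf x,t),P_j(\mathbf x,t))_{j\le N_e}$ and of final branches with value $\hat S(\mathbf x)$. 2. *Generalize*: replace $P_j$ by $$\tilde P_j(\mathbf x,t)=\exists t_1\Bigl(1\le t_1\le t\wedge P_j(\mathbf x,t_1)\wedge\neg\exists t_2\bigl(t_1<t_2\le t\wedge\textstyle\bigvee_iP_i(\mathbf x,t_2)\bigr)\Bigr)$$ and $E_j$ by its value at this last update time $t_1$; the value is $\hat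 S(\mathbf x)$ where no $\tilde P_j$ holds. This is $S^{\mathrm{general}}$. 3. *Shift* $t\mapsto t-1$ in $S^{\mathrm{general}}$, take the result as the summary of $v$, and perform a forward sweep again; this yields $S^{(t)}$. 4. Stop if $S^{(t)}$ *matches* $S^{\mathrm{general}}$; otherwise go to 2. Two summaries match if for all values of the symbols, all $1\le t\le N_k$ and all $\mathbf x$, an update branch applies in both or a final branch applies in both, with the same element. **Theorem.** For every SCC $C$ of an invariant subgraph of a level-$k$ loop ($1\le k\le K$) in a $d$-dimensional $m$-point stencil computation, and for all data as above, there is a positive integer $n_{\mathrm{iter}}$ such that the iterative semantic extraction has converged after $n_{\mathrm{iter}}$ sweeps (steps 2–3): the test of step 4 passes at the $n_{\mathrm{iter}}$-th sweep and at every later one, and, for each $n\ge n_{\mathrm{iter}}$, the summary of every vertex of $C$ after $n$ sweeps matches its summary after $n_{\mathrm{iter}}$ sweeps. -/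

import Mathlib

open scoped Classical

noncomputable section

namespace StencilLifting

/-! ### Values -/

/-- Scalar data types of the intermediate representation. -/
inductive ScalarTy
  | index
  | num
  | bool

/-- Data types: scalars, and arrays of numbers with `r` integer indices. -/
inductive Ty
  | scalar (s : ScalarTy)
  | array (r : ℕ)

abbrev Ty.index : Ty := .scalar .index
abbrev Ty.num : Ty := .scalar .num
abbrev Ty.bool : Ty := .scalar .bool

/-- The values of a scalar type. -/
abbrev ScalarTy.El : ScalarTy → Type
  | .index => ℤ
  | .num => ℝ
  | .bool => Prop

/-- The positions of a datum: a scalar has one position, an array of rank `r` has the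
positions `𝐱 ∈ ℤ ^ r`. -/
abbrev Pos : Ty → Type
  | .scalar _ => Unit
  | .array r => Fin r → ℤ

/-- What a datum stores at one position. -/
abbrev Elem : Ty → Type
  | .scalar s => s.El
  | .array _ => ℝ

/-- Concrete values. -/
abbrev Val (τ : Ty) : Type := Pos τ → Elem τ

instance Elem.instInhabited : (τ : Ty) → Inhabited (Elem τ)
  | .scalar .index => ⟨(0 : ℤ)⟩
  | .scalar .num => ⟨(0 : ℝ)⟩
  | .scalar .bool => ⟨False⟩
  | .array _ => ⟨(0 : ℝ)⟩

/-! ### Operations and dependency graphs -/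

/-- The operation attribute of a vertex of type `τ`, together with its ordered operands, which
are vertices of the family `V` (the family is indexed by the data type).

* `input`: a free symbol.
* `bound b e s`: the loop counter, which runs from `b` to `e` with step `s`.
* `lit`, `un`, `bin`: scalar operations with no, one, two operands.
* `get a i`: the element of `a` at index `i`;  `set a i x`: the array `a` with `x` written at `i`.
* `phi n c u o`: the value `u i` on the path with condition `c i`, for `i < n`, and the value `o`
  on the remaining path, where no `c i` holds.
* `loopcall n σ args o`: the inner loop, executed completely as a function of the actual
  arguments `args` and of the initial value `o` of its output variable. -/
inductive Op (V : Ty → Type) : Ty → Type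
  | input {τ : Ty} : Op V τ
  | bound (b e s : V Ty.index) : Op V Ty.index
  | lit {s : ScalarTy} (c : s.El) : Op V (.scalar s)
  | un {s₁ s : ScalarTy} (f : s₁.El → s.El) (u : V (.scalar s₁)) : Op V (.scalar s)
  | bin {s₁ s₂ s : ScalarTy} (f : s₁.El → s₂.El → s.El)
      (u : V (.scalar s₁)) (w : V (.scalar s₂)) : Op V (.scalar s)
  | get {r : ℕ} (a : V (.array r)) (i : Fin r → V Ty.index) : Op V Ty.num
  | set {r : ℕ} (a : V (.array r)) (i : Fin r → V Ty.index) (x : V Ty.num) : Op V (.array r)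
  | phi {τ : Ty} (n : ℕ) (c : Fin n → V Ty.bool) (u : Fin n → V τ) (o : V τ) : Op V τ
  | loopcall {τ : Ty} (n : ℕ) (σ : Fin n → Ty) (args : (j : Fin n) → V (σ j)) (o : V τ) : Op V τ

/-- `o.Uses p`: the vertex `p` is an operand of `o`. -/
def Op.Uses {V : Ty → Type} {τ : Ty} (o : Op V τ) (p : Σ τ, V τ) : Prop :=
  match o with
  | .input => False
  | .bound b e s => p = ⟨_, b⟩ ∨ p = ⟨_, e⟩ ∨ p = ⟨_, s⟩
  | .lit _ => False
  | .un _ u => p = ⟨_, u⟩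
  | .bin _ u w => p = ⟨_, u⟩ ∨ p = ⟨_, w⟩
  | .get a i => p = ⟨_, a⟩ ∨ ∃ j, p = ⟨_, i j⟩
  | .set a i x => p = ⟨_, a⟩ ∨ (∃ j, p = ⟨_, i j⟩) ∨ p = ⟨_, x⟩
  | .phi _ c u o => (∃ j, p = ⟨_, c j⟩) ∨ (∃ j, p = ⟨_, u j⟩) ∨ p = ⟨_, o⟩
  | .loopcall _ _ args o => (∃ j, p = ⟨_, args j⟩) ∨ p = ⟨_, o⟩

def Op.IsInput {V : Ty → Type} {τ : Ty} (o : Op V τ) : Prop := o = .input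

def Op.IsLoopcall {V : Ty → Type} {τ : Ty} (o : Op V τ) : Prop :=
  ∃ n σ args b, o = .loopcall n σ args b

/-- `OpRel R o o'`: `o` and `o'` are the same operation with operands that correspond under `R`.
Two `φ` functions always correspond, since the `φ` functions of an invariant subgraph are extended
so as to merge the paths of all iterations. -/
inductive OpRel {V W : Ty → Type} (R : ∀ τ, V τ → W τ → Prop) : ∀ {τ}, Op V τ → Op W τ → Prop
  | input {τ : Ty} : OpRel R (.input : Op V τ) .input
  | bound {b e s : V Ty.index} {b' e' s' : W Ty.index} :
      R _ b b' → R _ e e' → R _ s s' → OpRel R (.bound b e s) (.bound b' e' s')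
  | lit {s : ScalarTy} (c : s.El) : OpRel R (.lit c) (.lit c)
  | un {s₁ s : ScalarTy} (f : s₁.El → s.El) {u : V (.scalar s₁)} {u' : W (.scalar s₁)} :
      R _ u u' → OpRel R (.un f u) (.un f u')
  | bin {s₁ s₂ s : ScalarTy} (f : s₁.El → s₂.El → s.El) {u : V (.scalar s₁)}
      {u' : W (.scalar s₁)} {w : V (.scalar s₂)} {w' : W (.scalar s₂)} :
      R _ u u' → R _ w w' → OpRel R (.bin f u w) (.bin f u' w')
  | get {r : ℕ} {a : V (.array r)} {a' : W (.array r)} {i : Fin r → V Ty.index}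
      {i' : Fin r → W Ty.index} :
      R _ a a' → (∀ j, R _ (i j) (i' j)) → OpRel R (.get a i) (.get a' i')
  | set {r : ℕ} {a : V (.array r)} {a' : W (.array r)} {i : Fin r → V Ty.index}
      {i' : Fin r → W Ty.index} {x : V Ty.num} {x' : W Ty.num} :
      R _ a a' → (∀ j, R _ (i j) (i' j)) → R _ x x' → OpRel R (.set a i x) (.set a' i' x')
  | phi {τ : Ty} {n n' : ℕ} (c : Fin n → V Ty.bool) (u : Fin n → V τ) (o : V τ)
      (c' : Fin n' → W Ty.bool) (u' : Fin n' → W τ) (o' : W τ) :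
      OpRel R (.phi n c u o) (.phi n' c' u' o')
  | loopcall {τ : Ty} {n : ℕ} {σ : Fin n → Ty} {args : (j : Fin n) → V (σ j)}
      {args' : (j : Fin n) → W (σ j)} {o : V τ} {o' : W τ} :
      (∀ j, R _ (args j) (args' j)) → R _ o o' →
      OpRel R (.loopcall n σ args o) (.loopcall n σ args' o')

/-- A finite data dependency graph whose vertices carry data types and operations. -/
structure DepGraph where
  /-- the vertices of each data type -/
  V : Ty → Type
  finite : Finite (Σ τ, V τ)
  /-- the operation attribute, with the operands -/
  op : ∀ {τ}, V τ → Op V τ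

namespace DepGraph

abbrev Vertex (H : DepGraph) : Type := Σ τ, H.V τ

/-- `H.Edge p q`: the datum at `q` is computed from the datum at `p`. -/
def Edge (H : DepGraph) (p q : H.Vertex) : Prop := (H.op q.2).Uses p

/-- Strongly connected components: the maximal nonempty sets of vertices in which every vertex is
reachable from every other one. -/
def IsSCC (H : DepGraph) (C : Set H.Vertex) : Prop :=
  Maximal (fun D : Set H.Vertex =>
    D.Nonempty ∧ ∀ p ∈ D, ∀ q ∈ D, Relation.ReflTransGen H.Edge p q) C

end DepGraph

/-! ### Multilevel graphs of nested loops -/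

/-- The single-static-assignment multilevel graph of a `K`-level nested loop: one vertex for each
variable instance. Level `1` is the innermost loop. -/
structure SMG (K : ℕ) extends DepGraph where
  /-- the level attribute -/
  level : toDepGraph.Vertex → ℕ
  /-- the first loop attribute: which invocation of the loop of this level -/
  call : toDepGraph.Vertex → ℕ
  /-- the second loop attribute: which iteration of this invocation -/
  iter : toDepGraph.Vertex → ℕ
  /-- the number of invocations of the loop of each level -/
  M : ℕ → ℕ
  /-- the number of iterations of the loop of each level -/
  N : ℕ → ℕ
  /-- the name of the program variable; it matters for the input vertices of the kernel -/
  var : ∀ {τ}, V τ → ℕ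
  /-- for a formal parameter of a loop: the vertex of the enclosing loop passed for it -/
  source : ∀ {τ}, V τ → Option (V τ)
  /-- for a loop call: the vertex that holds the final value of the inner loop's output -/
  result : ∀ {τ}, V τ → Option (V τ)
  level_mem : ∀ v, level v ∈ Finset.Icc 1 K
  call_mem : ∀ v, call v ∈ Finset.Icc 1 (M (level v))
  iter_mem : ∀ v, iter v ∈ Finset.Icc 1 (N (level v))
  /-- operands belong to the same invocation of the same loop, and not to a later iteration -/
  edge_spec : ∀ p q, toDepGraph.Edge p q → level p = level q ∧ call p = call q ∧ iter p ≤ iter q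
  /-- only input vertices have a source; it is an actual argument of the call that invokes the
  loop to which the input vertex belongs -/
  source_spec : ∀ {τ} (w u : V τ), source w = some u → (op w).IsInput ∧
    level ⟨τ, u⟩ = level ⟨τ, w⟩ + 1 ∧
    ∃ (τ' : Ty) (v r : V τ'), result v = some r ∧ toDepGraph.Edge ⟨τ, u⟩ ⟨τ', v⟩ ∧
      level ⟨τ', r⟩ = level ⟨τ, w⟩ ∧ call ⟨τ', r⟩ = call ⟨τ, w⟩
  /-- the inputs of the loops below the top level are formal parameters -/
  source_isSome : ∀ {τ} (w : V τ), (op w).IsInput → level ⟨τ, w⟩ < K → (source w).isSome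
  /-- the result of a call lies in the last iteration of an invocation of the next inner loop -/
  result_spec : ∀ {τ} (v r : V τ), result v = some r → (op v).IsLoopcall ∧
    level ⟨τ, v⟩ = level ⟨τ, r⟩ + 1 ∧ iter ⟨τ, r⟩ = N (level ⟨τ, r⟩)
  result_isSome : ∀ {τ} (v : V τ), (op v).IsLoopcall → (result v).isSome
  /-- data dependencies, within and across levels, are acyclic -/
  acyclic : WellFounded fun p q : toDepGraph.Vertex => toDepGraph.Edge p q ∨
    ∃ (τ : Ty) (u w : V τ), p = ⟨τ, u⟩ ∧ q = ⟨τ, w⟩ ∧ (source w = some u ∨ result w = some u)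

/-- Values of the program variables at the start of the kernel. -/
abbrev Inputs : Type := ∀ τ : Ty, ℕ → Val τ

/-- `o.Computes D n y`: in iteration `n`, the operation `o` yields `y` from the values `D` of its
operands. Inputs and loop calls are linked to other levels, see `SMG.IsExecution`. -/
def Op.Computes {V : Ty → Type} (D : ∀ τ, V τ → Val τ) (n : ℕ) {τ : Ty} (o : Op V τ)
    (y : Val τ) : Prop :=
  match o with
  | .input => True
  | .bound b e s =>
      y () = D _ b () + ((n : ℤ) - 1) * D _ s () ∧ y () ∈ Set.uIcc (D _ b () : ℤ) (D _ e ())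
  | .lit c => y () = c
  | .un f u => y () = f (D _ u ())
  | .bin f u w => y () = f (D _ u ()) (D _ w ())
  | .get a i => y () = D _ a (fun j => D _ (i j) ())
  | .set a i x => y = Function.update (D _ a) (fun j => D _ (i j) ()) (D Ty.num x ())
  | .phi _ c u o =>
      (∀ i, D _ (c i) () → (∀ j < i, ¬ D _ (c j) ()) → y = D _ (u i)) ∧
        ((∀ i, ¬ D _ (c i) ()) → y = D _ o)
  | .loopcall _ _ _ _ => True

namespace SMG

/-- `D` assigns to every vertex the value that its variable instance has when the kernel is run on
the inputs `ι`. -/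
def IsExecution {K : ℕ} (G : SMG K) (ι : Inputs) (D : ∀ τ, G.V τ → Val τ) : Prop :=
  (∀ (τ : Ty) (v : G.V τ), (G.op v).Computes D (G.iter ⟨τ, v⟩) (D τ v)) ∧
  (∀ (τ : Ty) (v : G.V τ), (G.op v).IsInput → G.source v = none → D τ v = ι τ (G.var v)) ∧
  (∀ (τ : Ty) (v u : G.V τ), G.source v = some u → D τ v = D τ u) ∧
  (∀ (τ : Ty) (v r : G.V τ), G.result v = some r → D τ v = D τ r)

/-- The kernel is a `d`-dimensional `m`-point stencil computation with input array `A` and output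
array `B`: once the scalar inputs are fixed, there are finitely many disjoint regions (the interior
and boundary regions), on each of which
`B[𝐱] = λ₁ * A[t₁ 𝐱] + ⋯ + λₘ * A[tₘ 𝐱]` with scalars `λⱼ` and affine maps `tⱼ`, and outside of
which `B` keeps its initial values. The kernel can be executed on at least one input. -/
def IsStencil {K : ℕ} (G : SMG K) (d m : ℕ) : Prop :=
  ∃ (A B : ℕ) (out : G.V (.array d)),
    G.level ⟨_, out⟩ = K ∧ G.call ⟨_, out⟩ = G.M K ∧ G.iter ⟨_, out⟩ = G.N K ∧
    (∃ (ι : Inputs) (D : ∀ τ, G.V τ → Val τ), G.IsExecution ι D) ∧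
    ∀ ι₀ : Inputs, ∃ (p : ℕ) (region : Fin p → Set (Fin d → ℤ)) (coef : Fin p → Fin m → ℝ)
        (t : Fin p → Fin m → ((Fin d → ℤ) →ᵃ[ℤ] (Fin d → ℤ))),
      Pairwise (Function.onFun Disjoint region) ∧
      ∀ (ι : Inputs) (D : ∀ τ, G.V τ → Val τ), (∀ s, ι (.scalar s) = ι₀ (.scalar s)) →
        G.IsExecution ι D →
          (∀ c, ∀ x ∈ region c, D _ out x = ∑ j, coef c j * ι (.array d) A (t c j x)) ∧
          (∀ x, (∀ c, x ∉ region c) → D _ out x = ι (.array d) B x)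

/-- The vertices of type `τ` of the loop slice of iteration `n` in invocation `i` of the level-`k`
loop. -/
abbrev Slice {K : ℕ} (G : SMG K) (k i n : ℕ) (τ : Ty) : Type :=
  {v : G.V τ // G.level ⟨τ, v⟩ = k ∧ G.call ⟨τ, v⟩ = i ∧ G.iter ⟨τ, v⟩ = n}

/-- `H` is an invariant subgraph of the (regular) level-`k` loop. There is a set `typ` of typical
slices, containing most slices of the loop; each of them is in bijection with `H`, the bijections
respect the operations, and they send the dependencies within an iteration and between iterations
of one invocation to edges of `H`. -/
def IsInvariantSubgraph {K : ℕ} (G : SMG K) (k : ℕ) (H : DepGraph) : Prop :=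
  ∃ (typ : Finset (ℕ × ℕ)) (f : ∀ s : typ, ∀ τ, G.Slice k s.1.1 s.1.2 τ ≃ H.V τ),
    typ ⊆ Finset.Icc 1 (G.M k) ×ˢ Finset.Icc 1 (G.N k) ∧
    G.M k * G.N k < 2 * typ.card ∧
    (∀ (s : typ) (τ : Ty) (v : G.Slice k s.1.1 s.1.2 τ),
      OpRel (fun τ' u w => ∀ (s' : typ) (u' : G.Slice k s'.1.1 s'.1.2 τ'), u'.1 = u → f s' τ' u' = w)
        (G.op v.1) (H.op (f s τ v))) ∧
    (∀ (s s' : typ) (τ τ' : Ty) (u : G.Slice k s.1.1 s.1.2 τ) (v : G.Slice k s'.1.1 s'.1.2 τ'),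
      s.1.1 = s'.1.1 → G.Edge ⟨τ, u.1⟩ ⟨τ', v.1⟩ → H.Edge ⟨τ, f s τ u⟩ ⟨τ', f s' τ' v⟩)

end SMG

/-! ### Summaries -/

/-- A branch `cond → expr` of a summary. Both parts may depend on the values `θ : Θ` of the free
symbols, on the iteration variable `t`, and on the position `𝐱`. The flag `upd` is `true` for a
branch that describes an update, and `false` for a final branch, which holds the value with which
the start vertex of the current extraction was initialized. -/
structure Branch (Θ : Type) (τ : Ty) where
  upd : Bool
  cond : Θ → ℤ → Pos τ → Prop
  expr : Θ → ℤ → Pos τ → Elem τ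

/-- A summary is a disjunction of branches. -/
abbrev Summary (Θ : Type) (τ : Ty) : Type := List (Branch Θ τ)

/-- The branch with condition `g ∧ cond`. -/
def Branch.guard {Θ : Type} {τ : Ty} (g : Θ → ℤ → Pos τ → Prop) (b : Branch Θ τ) : Branch Θ τ :=
  ⟨b.upd, fun θ t x => g θ t x ∧ b.cond θ t x, b.expr⟩

namespace Summary

variable {Θ : Type} {τ : Ty}

/-- The conditions are mutually exclusive and cover all cases. -/
def WellFormed (s : Summary Θ τ) : Prop :=
  s.Pairwise (fun b c => ∀ θ t x, ¬ (b.cond θ t x ∧ c.cond θ t x)) ∧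
    ∀ θ t x, ∃ b ∈ s, b.cond θ t x

/-- The branch that applies. -/
def active (s : Summary Θ τ) (θ : Θ) (t : ℤ) (x : Pos τ) : Option (Branch Θ τ) :=
  s.find? fun b => decide (b.cond θ t x)

/-- The datum that the summary describes. -/
def value (s : Summary Θ τ) (θ : Θ) (t : ℤ) (x : Pos τ) : Elem τ :=
  ((s.active θ t x).map fun b => b.expr θ t x).getD default

/-- Two summaries match over the iterations `1, …, N`: for all values of the free symbols and at
every position, either an update applies in both or the final branch applies in both, with the same
element. -/
def Equiv (N : ℕ) (s s' : Summary Θ τ) : Prop :=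
  ∀ (θ : Θ) (t : ℤ) (x : Pos τ), 1 ≤ t → t ≤ N →
    (s.active θ t x).map (fun b => (b.upd, b.expr θ t x)) =
      (s'.active θ t x).map (fun b => (b.upd, b.expr θ t x))

/-- A summary known from outside: none of its branches refers to the initialization of the
start vertex. -/
def asKnown (s : Summary Θ τ) : Summary Θ τ := s.map fun b => ⟨true, b.cond, b.expr⟩

/-- The initial summary of the start vertex. -/
def initial (e : Θ → Pos τ → Elem τ) : Summary Θ τ := [⟨false, fun _ _ _ => True, fun θ _ x => e θ x⟩]

/-- An update branch `b` of `s` applied at position `x` in iteration `t₁ ≤ t`, and no update of `s`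
applied at `x` in a later iteration up to `t`. -/
def LastAt (s : Summary Θ τ) (b : Branch Θ τ) (θ : Θ) (t : ℤ) (x : Pos τ) (t₁ : ℤ) : Prop :=
  1 ≤ t₁ ∧ t₁ ≤ t ∧ b.cond θ t₁ x ∧
    ¬ ∃ t₂, t₁ < t₂ ∧ t₂ ≤ t ∧ ∃ c ∈ s, c.upd = true ∧ c.cond θ t₂ x

/-- The region-wise form of an update branch `b` of `s`: its condition is that some iteration
`t₁ ≤ t` is the last one to update `x` and does so by `b`; its expression is that of `b`, with the
iteration variable replaced by the witness `t₁`, as a function of `x` and `t`. -/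
def genBranch (s : Summary Θ τ) (b : Branch Θ τ) : Branch Θ τ :=
  ⟨true, fun θ t x => ∃ t₁, s.LastAt b θ t x t₁,
    fun θ t x => if h : ∃ t₁, s.LastAt b θ t x t₁ then b.expr θ h.choose x else b.expr θ t x⟩

/-- The generalization: the region-wise forms of the update branches, and the initial summary `e`
wherever none of them applies. -/
def generalize (e : Θ → Pos τ → Elem τ) (s : Summary Θ τ) : Summary Θ τ :=
  let g := (s.filter fun b => b.upd).map s.genBranch
  g ++ [⟨false, fun θ t x => ¬ ∃ b ∈ g, b.cond θ t x, fun θ _ x => e θ x⟩]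

/-- The time shift `t ↦ t - 1`. -/
def shift (s : Summary Θ τ) : Summary Θ τ :=
  s.map fun b => ⟨b.upd, fun θ t x => b.cond θ (t - 1) x, fun θ t x => b.expr θ (t - 1) x⟩

end Summary

/-- The postcondition of an inner loop, for the output variable of type `τ`: branches over the
values `a` of the formal parameters of types `σ` and the initial value `o` of the output variable.
Where no branch applies, the output variable keeps its initial value. -/
structure Post {n : ℕ} (σ : Fin n → Ty) (τ : Ty) where
  branches : List ((((j : Fin n) → Val (σ j)) → Val τ → Pos τ → Prop) ×
    (((j : Fin n) → Val (σ j)) → Val τ → Pos τ → Elem τ))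
  disjoint : branches.Pairwise fun b c => ∀ a o x, ¬ (b.1 a o x ∧ c.1 a o x)

namespace DepGraph

/-- Values of the symbols that the input vertices introduce. -/
abbrev Env (H : DepGraph) : Type := ∀ τ, H.V τ → Val τ

/-- A summary for every vertex. -/
abbrev Tensor (H : DepGraph) : Type := ∀ v : H.Vertex, Summary H.Env v.1

/-- A postcondition of the inner loop for every loop call. -/
abbrev Posts (H : DepGraph) : Type :=
  ∀ {τ : Ty}, H.V τ → ∀ {n : ℕ} (σ : Fin n → Ty), Post σ τ

/-- The summary rules: the summary of `v` from its operation and the summaries of its operands. -/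
def rule (H : DepGraph) (post : H.Posts) (S : H.Tensor) {τ : Ty} (v : H.V τ) : Summary H.Env τ :=
  match τ, v, H.op v with
  | τ, v, .input => [⟨true, fun _ _ _ => True, fun θ _ x => θ τ v x⟩]
  | _, _, .bound b _ s => [⟨true, fun _ _ _ => True, fun θ t _ =>
      ((S ⟨_, b⟩).value θ t () + (t - 1) * (S ⟨_, s⟩).value θ t () : ℤ)⟩]
  | _, _, .lit c => [⟨true, fun _ _ _ => True, fun _ _ _ => c⟩]
  | _, _, .un f u => (S ⟨_, u⟩).map fun b => ⟨true, b.cond, fun θ t x => f (b.expr θ t x)⟩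
  | _, _, .bin f u w => (S ⟨_, u⟩).flatMap fun b => (S ⟨_, w⟩).map fun c =>
      ⟨true, fun θ t x => b.cond θ t x ∧ c.cond θ t x,
        fun θ t x => f (b.expr θ t x) (c.expr θ t x)⟩
  | _, _, .get a i => (S ⟨_, a⟩).map fun b =>
      ⟨true, fun θ t _ => b.cond θ t fun j => (S ⟨_, i j⟩).value θ t (),
        fun θ t _ => b.expr θ t fun j => (S ⟨_, i j⟩).value θ t ()⟩
  | _, _, .set a i w =>
      (S ⟨_, w⟩).map (fun b =>
        ⟨true, fun θ t x => (x = fun j => (S ⟨_, i j⟩).value θ t ()) ∧ b.cond θ t (),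
          fun θ t _ => b.expr θ t ()⟩) ++
      (S ⟨_, a⟩).map (Branch.guard fun θ t x => x ≠ fun j => (S ⟨_, i j⟩).value θ t ())
  | _, _, .phi _ c u o =>
      (List.ofFn fun i => (S ⟨_, u i⟩).map (Branch.guard fun θ t _ =>
        (S ⟨_, c i⟩).value θ t () ∧ ∀ j < i, ¬ (S ⟨_, c j⟩).value θ t ())).flatten ++
      (S ⟨_, o⟩).map (Branch.guard fun θ t _ => ∀ j, ¬ (S ⟨_, c j⟩).value θ t ())
  | _, v, .loopcall _ σ args o =>
      let p := (post v σ).branches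
      let a := fun θ t j => (S ⟨_, args j⟩).value θ t
      let b := (S ⟨_, o⟩).value
      p.map (fun q => ⟨true, fun θ t x => q.1 (a θ t) (b θ t) x,
        fun θ t x => q.2 (a θ t) (b θ t) x⟩) ++
      (S ⟨_, o⟩).map (Branch.guard fun θ t x => ∀ q ∈ p, ¬ q.1 (a θ t) (b θ t) x)

/-- A forward sweep: the rules are applied at the vertices of `order`, in this order, and at the
start vertex at the end. -/
def forwardSweep (H : DepGraph) (post : H.Posts) (order : List H.Vertex) (start : H.Vertex)
    (S : H.Tensor) : H.Tensor :=
  (order ++ [start]).foldl (fun T v => Function.update T v (H.rule post T v.2)) S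

/-- The data on which the iterative semantic extraction runs within a strongly connected component
`C` of `H`, for a loop with `N` iterations. -/
structure Extraction (H : DepGraph) (C : Set H.Vertex) (N : ℕ) where
  /-- summaries; those of the vertices outside of `C` are known -/
  known : H.Tensor
  known_wellFormed : ∀ v ∉ C, (known v).WellFormed
  /-- the postconditions of the inner loop, for the loop calls in `C` -/
  post : H.Posts
  /-- the start vertex -/
  start : H.Vertex
  start_mem : start ∈ C
  /-- the initial summary of the start vertex -/
  init : H.Env → Pos start.1 → Elem start.1
  /-- if `C` contains an edge, the start vertex has a predecessor outside of `C` whose known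
  summary `init` does not depend on the iteration (a component without edges is a single vertex,
  whose rule uses known summaries only) -/
  init_spec : (∃ p ∈ C, ∃ q ∈ C, H.Edge p q) →
    ∃ u : H.V start.1, ⟨start.1, u⟩ ∉ C ∧ H.Edge ⟨start.1, u⟩ start ∧
      ∀ (θ : H.Env) (t : ℤ) (x : Pos start.1), 1 ≤ t → t ≤ N →
        (known ⟨start.1, u⟩).value θ t x = init θ x
  /-- the order in which a sweep visits the other vertices of `C` -/
  order : List H.Vertex
  order_nodup : order.Nodup
  mem_order : ∀ v, v ∈ order ↔ v ∈ C ∧ v ≠ start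
  /-- when a vertex is visited, its predecessors in `C` have been visited -/
  order_spec : ∀ (l₁ l₂ : List H.Vertex) (v : H.Vertex), order = l₁ ++ v :: l₂ →
    ∀ u ∈ C, H.Edge u v → u = start ∨ u ∈ l₁

namespace Extraction

variable {H : DepGraph} {C : Set H.Vertex} {N : ℕ} (R : H.Extraction C N)

/-- One forward sweep, from the summary `s` of the start vertex. -/
def sweepFrom (T : H.Tensor) (s : Summary H.Env R.start.1) : H.Tensor :=
  H.forwardSweep R.post R.order R.start (Function.update T R.start s)

/-- The generalization of the summary that the start vertex has in `T`. -/
def general (T : H.Tensor) : Summary H.Env R.start.1 := (T R.start).generalize R.init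

/-- The summaries after the first forward sweep and `n` further sweeps, each of which consists of a
generalization, a time shift, and a forward sweep. -/
def state : ℕ → H.Tensor
  | 0 => R.sweepFrom (fun v => if v ∈ C then R.known v else (R.known v).asKnown)
      (Summary.initial R.init)
  | n + 1 => R.sweepFrom (state n) (R.general (state n)).shift

/-- The convergence test at the end of the `n`-th sweep, for `n ≥ 1`: the updated summary of the
start vertex matches the generalized summary from which the sweep was started. -/
def TestPasses (n : ℕ) : Prop :=
  (R.state n R.start).Equiv N (R.general (R.state (n - 1)))

end Extraction

end DepGraph

end StencilLifting

end

/-!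
The extraction converges because a loop has finitely many iterations and every sweep settles at
least one more of them.

Call two summaries in agreement in iteration `t` if they describe the same elements with the same
update flags there (`Summary.AgreeAt`). The rules of the operations keep summaries mutually
exclusive and exhaustive (`DepGraph.rule_wellFormed`), and the result of a rule in iteration `t` is
determined by what its operands describe in iteration `t` (`DepGraph.rule_agreeAt`); both pass to
sweeps by induction along the order of the sweep. The shifted generalization in iteration `t` is
determined by the iterations `1, …, t - 1` (`Summary.AgreeAt.generalize`), and it is the initial
summary for `t = 1`. By induction, the states after `n` and after `n + 1` further sweeps agree in
the iterations `1, …, n + 1` (`Extraction.state_agreeAt_succ`), so that nothing changes any more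
from `n = N` on.

It remains to see that the stable summary of the start vertex is its own generalization. Where an
update applies in iteration `t`, it is the last update up to `t`, so the generalization has the same
element. Where the final branch applies in iteration `t`, it is a copy of the final branch of the
shifted generalization at the same position, because the rules can only copy final branches
(`DepGraph.rule_final`); so no update happened before `t`, and the generalization in iteration `t`
is the initial summary there, too (`Extraction.testPasses_succ`).
-/

namespace StencilLifting

/-! ### The datum that a summary describes -/

namespace Summary

variable {Θ : Type} {τ : Ty}

/-- `s.Yields θ t x u y`: a branch of `s` with update flag `u` applies at `(θ, t, x)` and has the
element `y` there. For a well-formed summary this is the graph of a function of `(θ, t, x)`. -/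
def Yields (s : Summary Θ τ) (θ : Θ) (t : ℤ) (x : Pos τ) (u : Bool) (y : Elem τ) : Prop :=
  ∃ b ∈ s, b.cond θ t x ∧ b.upd = u ∧ b.expr θ t x = y

/-- Two summaries describe the same datum with the same update flags in iteration `t`. -/
def AgreeAt (t : ℤ) (s s' : Summary Θ τ) : Prop :=
  ∀ θ x u y, s.Yields θ t x u y ↔ s'.Yields θ t x u y

lemma AgreeAt.refl (t : ℤ) (s : Summary Θ τ) : AgreeAt t s s := fun _ _ _ _ => Iff.rfl

lemma AgreeAt.symm {t : ℤ} {s s' : Summary Θ τ} (h : AgreeAt t s s') : AgreeAt t s' s :=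
  fun θ x u y => (h θ x u y).symm

lemma AgreeAt.trans {t : ℤ} {s s' s'' : Summary Θ τ} (h : AgreeAt t s s')
    (h' : AgreeAt t s' s'') : AgreeAt t s s'' :=
  fun θ x u y => (h θ x u y).trans (h' θ x u y)

lemma WellFormed.eq_of_cond {s : Summary Θ τ} (h : s.WellFormed) {b c : Branch Θ τ} (hb : b ∈ s)
    (hc : c ∈ s) {θ : Θ} {t : ℤ} {x : Pos τ} (hbx : b.cond θ t x) (hcx : c.cond θ t x) :
    b = c := by
  by_contra hne
  have hsymm : Std.Symm (fun b c : Branch Θ τ => ∀ θ t x, ¬ (b.cond θ t x ∧ c.cond θ t x)) :=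
    ⟨fun _ _ H θ t x hh => H θ t x hh.symm⟩
  exact h.1.forall hb hc hne θ t x ⟨hbx, hcx⟩

lemma WellFormed.yields_unique {s : Summary Θ τ} (h : s.WellFormed) {θ : Θ} {t : ℤ} {x : Pos τ}
    {u u' : Bool} {y y' : Elem τ} (hy : s.Yields θ t x u y) (hy' : s.Yields θ t x u' y') :
    u = u' ∧ y = y' := by
  obtain ⟨b, hb, hbx, rfl, rfl⟩ := hy
  obtain ⟨c, hc, hcx, rfl, rfl⟩ := hy'
  obtain rfl := h.eq_of_cond hb hc hbx hcx
  exact ⟨rfl, rfl⟩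

lemma WellFormed.exists_yields {s : Summary Θ τ} (h : s.WellFormed) (θ : Θ) (t : ℤ) (x : Pos τ) :
    ∃ u y, s.Yields θ t x u y := by
  obtain ⟨b, hb, hbx⟩ := h.2 θ t x
  exact ⟨_, _, b, hb, hbx, rfl, rfl⟩

/-- Since well-formed summaries are total and single-valued, inclusion of graphs is equality. -/
lemma AgreeAt.of_imp {s s' : Summary Θ τ} {t : ℤ} (hs : s.WellFormed) (hs' : s'.WellFormed)
    (h : ∀ θ x u y, s.Yields θ t x u y → s'.Yields θ t x u y) : AgreeAt t s s' := by
  refine fun θ x u y => ⟨h θ x u y, fun hy => ?_⟩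
  obtain ⟨u', y', hy'⟩ := hs.exists_yields θ t x
  obtain ⟨rfl, rfl⟩ := hs'.yields_unique hy (h θ x u' y' hy')
  exact hy'

lemma WellFormed.active_map_eq_some_iff {s : Summary Θ τ} (h : s.WellFormed) {θ : Θ} {t : ℤ}
    {x : Pos τ} {u : Bool} {y : Elem τ} :
    (s.active θ t x).map (fun b => (b.upd, b.expr θ t x)) = some (u, y) ↔
      s.Yields θ t x u y := by
  have key : ∀ {u y}, (s.active θ t x).map (fun b => (b.upd, b.expr θ t x)) = some (u, y) →
      s.Yields θ t x u y := by
    intro u y hy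
    obtain ⟨b, hb, hby⟩ := Option.map_eq_some_iff.1 hy
    obtain ⟨rfl, rfl⟩ := Prod.mk.inj hby
    exact ⟨b, List.mem_of_find?_eq_some hb, by simpa using List.find?_some hb, rfl, rfl⟩
  refine ⟨key, fun hy => ?_⟩
  obtain ⟨b, hb⟩ : ∃ b, s.active θ t x = some b := by
    obtain ⟨c, hc, hcx⟩ := h.2 θ t x
    exact Option.isSome_iff_exists.1 (List.find?_isSome.2 ⟨c, hc, by simpa using hcx⟩)
  obtain ⟨rfl, rfl⟩ := h.yields_unique hy (key (by rw [hb]; rfl))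
  rw [hb]; rfl

lemma WellFormed.value_eq {s : Summary Θ τ} (h : s.WellFormed) {θ : Θ} {t : ℤ} {x : Pos τ}
    {u : Bool} {y : Elem τ} (hy : s.Yields θ t x u y) : s.value θ t x = y := by
  obtain ⟨b, hb, hby⟩ := Option.map_eq_some_iff.1 (h.active_map_eq_some_iff.2 hy)
  simp only [value, hb, Option.map_some, Option.getD_some]
  exact congrArg Prod.snd hby

lemma AgreeAt.value_eq {s s' : Summary Θ τ} {t : ℤ} (h : AgreeAt t s s') (hs : s.WellFormed)
    (hs' : s'.WellFormed) (θ : Θ) : s.value θ t = s'.value θ t := by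
  funext x
  obtain ⟨u, y, hy⟩ := hs.exists_yields θ t x
  rw [hs.value_eq hy, hs'.value_eq ((h θ x u y).1 hy)]

lemma Equiv.of_agreeAt {N : ℕ} {s s' : Summary Θ τ} (hs : s.WellFormed) (hs' : s'.WellFormed)
    (h : ∀ t : ℤ, 1 ≤ t → t ≤ N → AgreeAt t s s') : s.Equiv N s' := by
  intro θ t x h1 hN
  apply Option.ext
  rintro ⟨u, y⟩
  exact hs.active_map_eq_some_iff.trans ((h t h1 hN θ x u y).trans hs'.active_map_eq_some_iff.symm)

/-! ### Well-formedness of the elementary constructions -/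

lemma wellFormed_singleton {b : Branch Θ τ} (h : ∀ θ t x, b.cond θ t x) :
    WellFormed [b] :=
  ⟨List.pairwise_singleton _ _, fun θ t x => ⟨b, List.mem_singleton.2 rfl, h θ t x⟩⟩

/-- A map of branches that evaluates the old conditions at positions depending on the new ones. -/
lemma WellFormed.map {σ : Ty} {s : Summary Θ σ} (h : s.WellFormed) (f : Branch Θ σ → Branch Θ τ)
    (p : Θ → ℤ → Pos τ → ℤ × Pos σ)
    (hf : ∀ b θ t x, (f b).cond θ t x ↔ b.cond θ (p θ t x).1 (p θ t x).2) :
    WellFormed (List.map f s) := by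
  refine ⟨List.pairwise_map.2 (h.1.imp fun H θ t x => ?_), fun θ t x => ?_⟩
  · rw [hf, hf]; exact H _ _ _
  · obtain ⟨b, hb, hbx⟩ := h.2 θ (p θ t x).1 (p θ t x).2
    exact ⟨f b, List.mem_map_of_mem hb, (hf _ _ _ _).2 hbx⟩

lemma pairwise_guard {s : Summary Θ τ} (h : s.WellFormed) (g : Θ → ℤ → Pos τ → Prop) :
    (s.map (Branch.guard g)).Pairwise (fun b c => ∀ θ t x, ¬ (b.cond θ t x ∧ c.cond θ t x)) :=
  List.pairwise_map.2 (h.1.imp fun H θ t x hh => H θ t x ⟨hh.1.2, hh.2.2⟩)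

lemma WellFormed.asKnown {s : Summary Θ τ} (h : s.WellFormed) : s.asKnown.WellFormed :=
  h.map _ (fun _ t x => (t, x)) fun _ _ _ _ => Iff.rfl

lemma WellFormed.shift {s : Summary Θ τ} (h : s.WellFormed) : s.shift.WellFormed :=
  h.map _ (fun _ t x => (t - 1, x)) fun _ _ _ _ => Iff.rfl

lemma initial_wellFormed (e : Θ → Pos τ → Elem τ) : (initial e).WellFormed :=
  wellFormed_singleton fun _ _ _ => trivial

lemma initial_yields_iff {e : Θ → Pos τ → Elem τ} {θ : Θ} {t : ℤ} {x : Pos τ} {u : Bool}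
    {y : Elem τ} : (initial e).Yields θ t x u y ↔ u = false ∧ y = e θ x := by
  simp [Yields, initial, eq_comm]

lemma shift_yields_iff {s : Summary Θ τ} {θ : Θ} {t : ℤ} {x : Pos τ} {u : Bool}
    {y : Elem τ} : s.shift.Yields θ t x u y ↔ s.Yields θ (t - 1) x u y := by
  simp [Yields, shift]

/-! ### Generalization -/

lemma lastAt_unique {s : Summary Θ τ} {b c : Branch Θ τ} (hb : b ∈ s) (hc : c ∈ s)
    (hbu : b.upd = true) (hcu : c.upd = true)
    {θ : Θ} {t : ℤ} {x : Pos τ} {t₁ t₂ : ℤ} (h₁ : s.LastAt b θ t x t₁)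
    (h₂ : s.LastAt c θ t x t₂) : t₁ = t₂ := by
  obtain ⟨_, h₁t, h₁x, h₁n⟩ := h₁
  obtain ⟨_, h₂t, h₂x, h₂n⟩ := h₂
  rcases lt_trichotomy t₁ t₂ with h | h | h
  · exact (h₁n ⟨t₂, h, h₂t, c, hc, hcu, h₂x⟩).elim
  · exact h
  · exact (h₂n ⟨t₁, h, h₁t, b, hb, hbu, h₁x⟩).elim

lemma WellFormed.generalize {s : Summary Θ τ} (h : s.WellFormed) (e : Θ → Pos τ → Elem τ) :
    (s.generalize e).WellFormed := by
  refine ⟨List.pairwise_append.2 ⟨List.pairwise_map.2 ?_, List.pairwise_singleton _ _, ?_⟩, ?_⟩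
  · refine List.Pairwise.imp_of_mem ?_ (h.1.filter _)
    rintro b c hb hc H θ t x ⟨⟨t₁, h₁⟩, ⟨t₂, h₂⟩⟩
    rw [List.mem_filter] at hb hc
    obtain rfl := lastAt_unique hb.1 hc.1 hb.2 hc.2 h₁ h₂
    exact H θ t₁ x ⟨h₁.2.2.1, h₂.2.2.1⟩
  · rintro b hb c hc θ t x ⟨hbx, hcx⟩
    rw [List.mem_singleton] at hc
    subst hc
    exact hcx ⟨b, hb, hbx⟩
  · intro θ t x
    by_cases hg : ∃ b ∈ (s.filter fun b => b.upd).map s.genBranch, b.cond θ t x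
    · obtain ⟨b, hb, hbx⟩ := hg
      exact ⟨b, List.mem_append_left _ hb, hbx⟩
    · exact ⟨_, List.mem_append_right _ (List.mem_singleton.2 rfl), hg⟩

/-- A nonempty set of update times up to `t` has a last element, at which the region-wise form of
the updating branch applies. -/
lemma exists_lastAt {s : Summary Θ τ} {θ : Θ} {t : ℤ} {x : Pos τ}
    (h : ∃ t₁, 1 ≤ t₁ ∧ t₁ ≤ t ∧ ∃ y, s.Yields θ t₁ x true y) :
    ∃ b ∈ s, b.upd = true ∧ ∃ t₁, s.LastAt b θ t x t₁ := by
  obtain ⟨t₁, ⟨h1, ht, y, b, hb, hbx, hbu, -⟩, hmax⟩ := Int.exists_greatest_of_bdd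
    (P := fun t₁ => 1 ≤ t₁ ∧ t₁ ≤ t ∧ ∃ y, s.Yields θ t₁ x true y) ⟨t, fun z hz => hz.2.1⟩ h
  refine ⟨b, hb, hbu, t₁, h1, ht, hbx, ?_⟩
  rintro ⟨t₂, hlt, h₂, c, hc, hcu, hcx⟩
  have := hmax t₂ ⟨by omega, h₂, _, c, hc, hcx, hcu, rfl⟩
  omega

/-- Generalization in terms of the described datum: the element written by the last update up to
`t`, or the initial element where there was no update. -/
lemma generalize_yields_iff {s : Summary Θ τ} {e : Θ → Pos τ → Elem τ} {θ : Θ}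
    {t : ℤ} {x : Pos τ} {u : Bool} {y : Elem τ} :
    (s.generalize e).Yields θ t x u y ↔
      (u = true ∧ ∃ t₁, 1 ≤ t₁ ∧ t₁ ≤ t ∧ s.Yields θ t₁ x true y ∧
        ¬ ∃ t₂, t₁ < t₂ ∧ t₂ ≤ t ∧ ∃ y', s.Yields θ t₂ x true y') ∨
      (u = false ∧ y = e θ x ∧ ¬ ∃ t₁, 1 ≤ t₁ ∧ t₁ ≤ t ∧ ∃ y', s.Yields θ t₁ x true y') := by
  have expr_eq : ∀ {b t₁}, b ∈ s → b.upd = true → s.LastAt b θ t x t₁ →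
      (s.genBranch b).expr θ t x = b.expr θ t₁ x := by
    intro b t₁ hb hbu hl
    have hex : ∃ t₁, s.LastAt b θ t x t₁ := ⟨t₁, hl⟩
    simp only [genBranch, dif_pos hex, lastAt_unique hb hb hbu hbu hex.choose_spec hl]
  constructor
  · rintro ⟨b, hb, hbx, rfl, rfl⟩
    rcases List.mem_append.1 hb with hb | hb
    · obtain ⟨b, hbf, rfl⟩ := List.mem_map.1 hb
      obtain ⟨hb, hbu⟩ := List.mem_filter.1 hbf
      obtain ⟨t₁, hl⟩ := hbx
      refine Or.inl ⟨rfl, t₁, hl.1, hl.2.1, ⟨b, hb, hl.2.2.1, hbu, (expr_eq hb hbu hl).symm⟩, ?_⟩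
      rintro ⟨t₂, hlt, h₂, y', c, hc, hcx, hcu, -⟩
      exact hl.2.2.2 ⟨t₂, hlt, h₂, c, hc, hcu, hcx⟩
    · obtain rfl := List.mem_singleton.1 hb
      refine Or.inr ⟨rfl, rfl, fun hex => hbx ?_⟩
      obtain ⟨b, hb, hbu, hl⟩ := exists_lastAt hex
      exact ⟨_, List.mem_map_of_mem (List.mem_filter.2 ⟨hb, hbu⟩), hl⟩
  · rintro (⟨rfl, t₁, h1, ht, ⟨b, hb, hbx, hbu, rfl⟩, hn⟩ | ⟨rfl, rfl, hn⟩)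
    · have hl : s.LastAt b θ t x t₁ := by
        refine ⟨h1, ht, hbx, ?_⟩
        rintro ⟨t₂, hlt, h₂, c, hc, hcu, hcx⟩
        exact hn ⟨t₂, hlt, h₂, _, c, hc, hcx, hcu, rfl⟩
      exact ⟨_, List.mem_append_left _ (List.mem_map_of_mem (List.mem_filter.2 ⟨hb, hbu⟩)),
        ⟨t₁, hl⟩, rfl, expr_eq hb hbu hl⟩
    · refine ⟨_, List.mem_append_right _ (List.mem_singleton.2 rfl), ?_, rfl, rfl⟩
      rintro ⟨b, hb, hbx⟩
      obtain ⟨b, hbf, rfl⟩ := List.mem_map.1 hb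
      obtain ⟨hb, hbu⟩ := List.mem_filter.1 hbf
      obtain ⟨t₁, hl⟩ := hbx
      exact hn ⟨t₁, hl.1, hl.2.1, _, b, hb, hl.2.2.1, hbu, rfl⟩

/-- The generalization at `t` depends on the iterations `1, …, t` only. -/
lemma AgreeAt.generalize {s s' : Summary Θ τ} {t : ℤ}
    (h : ∀ t₁, 1 ≤ t₁ → t₁ ≤ t → AgreeAt t₁ s s') (e : Θ → Pos τ → Elem τ) :
    AgreeAt t (s.generalize e) (s'.generalize e) := by
  suffices H : ∀ {s s' : Summary Θ τ}, (∀ t₁, 1 ≤ t₁ → t₁ ≤ t → AgreeAt t₁ s s') →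
      ∀ θ x u y, (s.generalize e).Yields θ t x u y → (s'.generalize e).Yields θ t x u y from
    fun θ x u y => ⟨H h θ x u y, H (fun t₁ h1 ht => (h t₁ h1 ht).symm) θ x u y⟩
  intro s s' h θ x u y
  rw [generalize_yields_iff, generalize_yields_iff]
  rintro (⟨hu, t₁, h1, ht, hy, hn⟩ | ⟨hu, hy, hn⟩)
  · refine Or.inl ⟨hu, t₁, h1, ht, (h t₁ h1 ht θ x _ _).1 hy, ?_⟩
    rintro ⟨t₂, hlt, h₂, y', hy'⟩
    exact hn ⟨t₂, hlt, h₂, y', (h t₂ (by omega) h₂ θ x _ _).2 hy'⟩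
  · refine Or.inr ⟨hu, hy, ?_⟩
    rintro ⟨t₂, h1, h₂, y', hy'⟩
    exact hn ⟨t₂, h1, h₂, y', (h t₂ h1 h₂ θ x _ _).2 hy'⟩

end Summary

/-! ### The summary rules -/

namespace DepGraph

open Summary

variable {H : DepGraph}

/-- The summary rules preserve mutual exclusivity and exhaustiveness. -/
lemma rule_wellFormed (post : H.Posts) {S : H.Tensor} {τ : Ty} (v : H.V τ)
    (hS : ∀ p, H.Edge p ⟨τ, v⟩ → (S p).WellFormed) : (H.rule post S v).WellFormed := by
  unfold Edge at hS
  unfold rule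
  dsimp only at hS
  generalize H.op v = o at hS ⊢
  cases o with
  | input => exact wellFormed_singleton fun _ _ _ => trivial
  | bound b e s => exact wellFormed_singleton fun _ _ _ => trivial
  | lit c => exact wellFormed_singleton fun _ _ _ => trivial
  | un f u => exact (hS ⟨_, u⟩ rfl).map _ (fun _ t x => (t, x)) fun _ _ _ _ => Iff.rfl
  | bin f u w =>
    have hu := hS ⟨_, u⟩ (Or.inl rfl)
    have hw := hS ⟨_, w⟩ (Or.inr rfl)
    refine ⟨List.pairwise_flatMap.2 ⟨fun b hb => ?_, ?_⟩, fun θ t x => ?_⟩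
    · exact List.pairwise_map.2 (hw.1.imp fun H θ t x hh => H θ t x ⟨hh.1.2, hh.2.2⟩)
    · refine hu.1.imp fun H b hb c hc θ t x hh => ?_
      obtain ⟨b, -, rfl⟩ := List.mem_map.1 hb
      obtain ⟨c, -, rfl⟩ := List.mem_map.1 hc
      exact H θ t x ⟨hh.1.1, hh.2.1⟩
    · obtain ⟨b, hb, hbx⟩ := hu.2 θ t x
      obtain ⟨c, hc, hcx⟩ := hw.2 θ t x
      exact ⟨_, List.mem_flatMap.2 ⟨b, hb, List.mem_map_of_mem hc⟩, hbx, hcx⟩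
  | get a i =>
    exact (hS ⟨_, a⟩ (Or.inl rfl)).map _
      (fun θ t _ => (t, fun j => (S ⟨_, i j⟩).value θ t ())) fun _ _ _ _ => Iff.rfl
  | set a i w =>
    have ha := hS ⟨_, a⟩ (Or.inl rfl)
    have hw := hS ⟨_, w⟩ (Or.inr (Or.inr rfl))
    refine ⟨List.pairwise_append.2 ⟨?_, pairwise_guard ha _, ?_⟩, fun θ t x => ?_⟩
    · exact List.pairwise_map.2 (hw.1.imp fun H θ t x hh => H θ t () ⟨hh.1.2, hh.2.2⟩)
    · intro b hb c hc θ t x hh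
      obtain ⟨b, -, rfl⟩ := List.mem_map.1 hb
      obtain ⟨c, -, rfl⟩ := List.mem_map.1 hc
      exact hh.2.1 hh.1.1
    · by_cases hx : x = fun j => (S ⟨_, i j⟩).value θ t ()
      · obtain ⟨b, hb, hbx⟩ := hw.2 θ t ()
        exact ⟨_, List.mem_append_left _ (List.mem_map_of_mem hb), hx, hbx⟩
      · obtain ⟨b, hb, hbx⟩ := ha.2 θ t x
        exact ⟨_, List.mem_append_right _ (List.mem_map_of_mem hb), hx, hbx⟩
  | phi n c u o =>
    have hu := fun i => hS ⟨_, u i⟩ (Or.inr (Or.inl ⟨i, rfl⟩))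
    have ho := hS ⟨_, o⟩ (Or.inr (Or.inr rfl))
    refine ⟨List.pairwise_append.2 ⟨List.pairwise_flatten.2 ⟨?_, ?_⟩, pairwise_guard ho _, ?_⟩,
      fun θ t x => ?_⟩
    · intro l hl
      obtain ⟨i, rfl⟩ := List.mem_ofFn.1 hl
      exact pairwise_guard (hu i) _
    · refine List.pairwise_ofFn.2 fun i j hij b hb c hc θ t x hh => ?_
      obtain ⟨b, -, rfl⟩ := List.mem_map.1 hb
      obtain ⟨c, -, rfl⟩ := List.mem_map.1 hc
      exact hh.2.1.2 i hij hh.1.1.1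
    · intro b hb c hc θ t x hh
      obtain ⟨l, hl, hb⟩ := List.mem_flatten.1 hb
      obtain ⟨i, rfl⟩ := List.mem_ofFn.1 hl
      obtain ⟨b, -, rfl⟩ := List.mem_map.1 hb
      obtain ⟨c, -, rfl⟩ := List.mem_map.1 hc
      exact hh.2.1 i hh.1.1.1
    · by_cases hc : ∃ i, (S ⟨_, c i⟩).value θ t ()
      · -- the first condition that holds selects the path
        obtain ⟨i, hi, hmin⟩ := WellFounded.has_min (wellFounded_lt (α := Fin n))
          {i | (S ⟨_, c i⟩).value θ t ()} hc
        obtain ⟨b, hb, hbx⟩ := (hu i).2 θ t x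
        exact ⟨_, List.mem_append_left _ (List.mem_flatten.2
          ⟨_, List.mem_ofFn.2 ⟨i, rfl⟩, List.mem_map_of_mem hb⟩),
          ⟨hi, fun j hj hcj => hmin j hcj hj⟩, hbx⟩
      · obtain ⟨b, hb, hbx⟩ := ho.2 θ t x
        exact ⟨_, List.mem_append_right _ (List.mem_map_of_mem hb), not_exists.1 hc, hbx⟩
  | loopcall n σ args o =>
    have ho := hS ⟨_, o⟩ (Or.inr rfl)
    refine ⟨List.pairwise_append.2 ⟨List.pairwise_map.2 ((post v σ).disjoint.imp
      fun H θ t x => H _ _ _), pairwise_guard ho _, ?_⟩, fun θ t x => ?_⟩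
    · intro b hb c hc θ t x hh
      obtain ⟨q, hq, rfl⟩ := List.mem_map.1 hb
      obtain ⟨c, -, rfl⟩ := List.mem_map.1 hc
      exact hh.2.1 q hq hh.1
    · by_cases hp : ∃ q ∈ (post v σ).branches,
          q.1 (fun j => (S ⟨_, args j⟩).value θ t) ((S ⟨_, o⟩).value θ t) x
      · obtain ⟨q, hq, hqx⟩ := hp
        exact ⟨_, List.mem_append_left _ (List.mem_map_of_mem hq), hqx⟩
      · obtain ⟨b, hb, hbx⟩ := ho.2 θ t x
        exact ⟨_, List.mem_append_right _ (List.mem_map_of_mem hb),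
          fun q hq hqx => hp ⟨q, hq, hqx⟩, hbx⟩

/-- Final branches are only ever copied: the rules take them from an operand of the same type, at
the same position, and with the same element. So every property `Q` of the elements of the final
branches of the operands is inherited. -/
lemma rule_final (post : H.Posts) {S : H.Tensor} {τ : Ty} (v : H.V τ)
    (Q : ∀ σ : Ty, H.Env → ℤ → Pos σ → Elem σ → Prop)
    (hS : ∀ p, H.Edge p ⟨τ, v⟩ → ∀ θ t x y, (S p).Yields θ t x false y → Q p.1 θ t x y)
    {θ : H.Env} {t : ℤ} {x : Pos τ} {y : Elem τ} (hy : (H.rule post S v).Yields θ t x false y) :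
    Q τ θ t x y := by
  unfold Edge at hS
  unfold rule at hy
  dsimp only at hS
  generalize H.op v = o at hS hy
  obtain ⟨b, hb, hbx, hbu, rfl⟩ := hy
  cases o with
  | input => obtain rfl := List.mem_singleton.1 hb; cases hbu
  | bound b e s => obtain rfl := List.mem_singleton.1 hb; cases hbu
  | lit c => obtain rfl := List.mem_singleton.1 hb; cases hbu
  | un f u => obtain ⟨c, -, rfl⟩ := List.mem_map.1 hb; cases hbu
  | bin f u w =>
    obtain ⟨c, -, hb⟩ := List.mem_flatMap.1 hb
    obtain ⟨c, -, rfl⟩ := List.mem_map.1 hb; cases hbu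
  | get a i => obtain ⟨c, -, rfl⟩ := List.mem_map.1 hb; cases hbu
  | set a i w =>
    rcases List.mem_append.1 hb with hb | hb
    · obtain ⟨c, -, rfl⟩ := List.mem_map.1 hb; cases hbu
    · obtain ⟨c, hc, rfl⟩ := List.mem_map.1 hb
      exact hS ⟨_, a⟩ (Or.inl rfl) θ t x _ ⟨c, hc, hbx.2, hbu, rfl⟩
  | phi n c u o =>
    rcases List.mem_append.1 hb with hb | hb
    · obtain ⟨l, hl, hb⟩ := List.mem_flatten.1 hb
      obtain ⟨i, rfl⟩ := List.mem_ofFn.1 hl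
      obtain ⟨c, hc, rfl⟩ := List.mem_map.1 hb
      exact hS ⟨_, u i⟩ (Or.inr (Or.inl ⟨i, rfl⟩)) θ t x _ ⟨c, hc, hbx.2, hbu, rfl⟩
    · obtain ⟨c, hc, rfl⟩ := List.mem_map.1 hb
      exact hS ⟨_, o⟩ (Or.inr (Or.inr rfl)) θ t x _ ⟨c, hc, hbx.2, hbu, rfl⟩
  | loopcall n σ args o =>
    rcases List.mem_append.1 hb with hb | hb
    · obtain ⟨c, -, rfl⟩ := List.mem_map.1 hb; cases hbu
    · obtain ⟨c, hc, rfl⟩ := List.mem_map.1 hb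
      exact hS ⟨_, o⟩ (Or.inr rfl) θ t x _ ⟨c, hc, hbx.2, hbu, rfl⟩

/-- The summary of a vertex in iteration `t` is determined by what the summaries of its operands
describe in iteration `t`. -/
lemma rule_agreeAt (post : H.Posts) {S S' : H.Tensor} {t : ℤ} {τ : Ty} (v : H.V τ)
    (hw : ∀ p, H.Edge p ⟨τ, v⟩ → (S p).WellFormed)
    (hw' : ∀ p, H.Edge p ⟨τ, v⟩ → (S' p).WellFormed)
    (hS : ∀ p, H.Edge p ⟨τ, v⟩ → AgreeAt t (S p) (S' p)) :
    AgreeAt t (H.rule post S v) (H.rule post S' v) := by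
  refine AgreeAt.of_imp (rule_wellFormed post v hw) (rule_wellFormed post v hw')
    fun θ x u y hy => ?_
  have hval := fun p hp => (hS p hp).value_eq (hw p hp) (hw' p hp) θ
  clear hw hw'
  unfold Edge at hS hval
  unfold rule at hy ⊢
  dsimp only at hS hval
  generalize H.op v = o at hS hval hy ⊢
  obtain ⟨b, hb, hbx, rfl, rfl⟩ := hy
  -- a branch of an operand that applies is matched by a branch of the corresponding operand
  have lift : ∀ p, o.Uses p → ∀ b ∈ S p, ∀ x, b.cond θ t x →
      ∃ b' ∈ S' p, b'.cond θ t x ∧ b'.upd = b.upd ∧ b'.expr θ t x = b.expr θ t x :=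
    fun p hp b hb x hbx => (hS p hp θ x _ _).1 ⟨b, hb, hbx, rfl, rfl⟩
  clear hS
  cases o with
  | input => exact ⟨b, hb, hbx, rfl, rfl⟩
  | bound b e s =>
    obtain rfl := List.mem_singleton.1 hb
    refine ⟨_, List.mem_singleton.2 rfl, trivial, rfl, ?_⟩
    dsimp only
    rw [hval ⟨_, b⟩ (Or.inl rfl), hval ⟨_, s⟩ (Or.inr (Or.inr rfl))]
  | lit c => exact ⟨b, hb, hbx, rfl, rfl⟩
  | un f u =>
    obtain ⟨b, hm, rfl⟩ := List.mem_map.1 hb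
    obtain ⟨b', hb', hbx', -, he⟩ := lift ⟨_, u⟩ rfl b hm x hbx
    exact ⟨_, List.mem_map_of_mem hb', hbx', rfl, congrArg f he⟩
  | bin f u w =>
    obtain ⟨b, hm, hc⟩ := List.mem_flatMap.1 hb
    obtain ⟨c, hm', rfl⟩ := List.mem_map.1 hc
    obtain ⟨b', hb', hbx', -, he⟩ := lift ⟨_, u⟩ (Or.inl rfl) b hm x hbx.1
    obtain ⟨c', hc', hcx', -, he'⟩ := lift ⟨_, w⟩ (Or.inr rfl) c hm' x hbx.2
    exact ⟨_, List.mem_flatMap.2 ⟨b', hb', List.mem_map_of_mem hc'⟩, ⟨hbx', hcx'⟩, rfl,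
      congrArg₂ f he he'⟩
  | get a i =>
    have hi := fun j => hval ⟨_, i j⟩ (Or.inr ⟨j, rfl⟩)
    obtain ⟨b, hm, rfl⟩ := List.mem_map.1 hb
    obtain ⟨b', hb', hbx', -, he⟩ := lift ⟨_, a⟩ (Or.inl rfl) b hm _ hbx
    refine ⟨_, List.mem_map_of_mem hb', ?_, rfl, ?_⟩
    · simpa only [hi] using hbx'
    · simpa only [hi] using he
  | set a i w =>
    have hi := fun j => hval ⟨_, i j⟩ (Or.inr (Or.inl ⟨j, rfl⟩))
    rcases List.mem_append.1 hb with hb | hb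
    · obtain ⟨b, hm, rfl⟩ := List.mem_map.1 hb
      obtain ⟨b', hb', hbx', -, he⟩ := lift ⟨_, w⟩ (Or.inr (Or.inr rfl)) b hm () hbx.2
      refine ⟨_, List.mem_append_left _ (List.mem_map_of_mem hb'), ⟨?_, hbx'⟩, rfl, he⟩
      simpa only [hi] using hbx.1
    · obtain ⟨b, hm, rfl⟩ := List.mem_map.1 hb
      obtain ⟨b', hb', hbx', hu, he⟩ := lift ⟨_, a⟩ (Or.inl rfl) b hm x hbx.2
      refine ⟨_, List.mem_append_right _ (List.mem_map_of_mem hb'), ⟨?_, hbx'⟩, hu, he⟩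
      simpa only [hi] using hbx.1
  | phi n c u o =>
    have hc := fun j => hval ⟨_, c j⟩ (Or.inl ⟨j, rfl⟩)
    rcases List.mem_append.1 hb with hb | hb
    · obtain ⟨l, hl, hb⟩ := List.mem_flatten.1 hb
      obtain ⟨i, rfl⟩ := List.mem_ofFn.1 hl
      obtain ⟨b, hm, rfl⟩ := List.mem_map.1 hb
      obtain ⟨b', hb', hbx', hu, he⟩ := lift ⟨_, u i⟩ (Or.inr (Or.inl ⟨i, rfl⟩)) b hm x hbx.2
      refine ⟨_, List.mem_append_left _ (List.mem_flatten.2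
        ⟨_, List.mem_ofFn.2 ⟨i, rfl⟩, List.mem_map_of_mem hb'⟩), ⟨?_, hbx'⟩, hu, he⟩
      simpa only [hc] using hbx.1
    · obtain ⟨b, hm, rfl⟩ := List.mem_map.1 hb
      obtain ⟨b', hb', hbx', hu, he⟩ := lift ⟨_, o⟩ (Or.inr (Or.inr rfl)) b hm x hbx.2
      refine ⟨_, List.mem_append_right _ (List.mem_map_of_mem hb'), ⟨?_, hbx'⟩, hu, he⟩
      simpa only [hc] using hbx.1
  | loopcall n σ args o =>
    have ha := fun j => hval ⟨_, args j⟩ (Or.inl ⟨j, rfl⟩)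
    have ho := hval ⟨_, o⟩ (Or.inr rfl)
    rcases List.mem_append.1 hb with hb | hb
    · obtain ⟨q, hq, rfl⟩ := List.mem_map.1 hb
      refine ⟨_, List.mem_append_left _ (List.mem_map_of_mem hq), ?_, rfl, ?_⟩
      · simpa only [ha, ho] using hbx
      · simp only [ha, ho]
    · obtain ⟨b, hm, rfl⟩ := List.mem_map.1 hb
      obtain ⟨b', hb', hbx', hu, he⟩ := lift ⟨_, o⟩ (Or.inr rfl) b hm x hbx.2
      refine ⟨_, List.mem_append_right _ (List.mem_map_of_mem hb'), ⟨?_, hbx'⟩, hu, he⟩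
      simpa only [ha, ho] using hbx.1

/-! ### Forward sweeps -/

lemma foldl_rule_of_notMem (post : H.Posts) {l : List H.Vertex} (T : H.Tensor) {v : H.Vertex}
    (hv : v ∉ l) :
    l.foldl (fun T v => Function.update T v (H.rule post T v.2)) T v = T v := by
  induction l generalizing T with
  | nil => rfl
  | cons w l ih =>
    rw [List.mem_cons, not_or] at hv
    rw [List.foldl_cons, ih _ hv.2, Function.update_of_ne hv.1]

/-- Induction along two parallel sweeps: a relation between the summaries of a vertex that the
rules preserve, and that holds on a set `D`, holds wherever a sweep arrives, provided that the sweep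
visits vertices only after their predecessors outside of `D`. -/
lemma foldl_rule_induction (post : H.Posts)
    (P : ∀ v : H.Vertex, Summary H.Env v.1 → Summary H.Env v.1 → Prop)
    (hP : ∀ (v : H.Vertex) (U U' : H.Tensor), (∀ p, H.Edge p v → P p (U p) (U' p)) →
      P v (H.rule post U v.2) (H.rule post U' v.2))
    (l : List H.Vertex) (D : Set H.Vertex) (T T' : H.Tensor) (hD : ∀ p ∈ D, P p (T p) (T' p))
    (hl : ∀ l₁ l₂ v, l = l₁ ++ v :: l₂ → ∀ p, H.Edge p v → p ∈ D ∨ p ∈ l₁) (p : H.Vertex)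
    (hp : p ∈ D ∨ p ∈ l) :
    P p (l.foldl (fun T v => Function.update T v (H.rule post T v.2)) T p)
      (l.foldl (fun T v => Function.update T v (H.rule post T v.2)) T' p) := by
  induction l generalizing D T T' with
  | nil => exact hD p (hp.resolve_right List.not_mem_nil)
  | cons w l ih =>
    refine ih (insert w D) _ _ (fun q hq => ?_) (fun l₁ l₂ v hv q hq => ?_) ?_
    · beta_reduce
      by_cases hqw : q = w
      · subst hqw
        rw [Function.update_self, Function.update_self]
        exact hP q T T' fun r hr =>
          hD r ((hl [] l q rfl r hr).resolve_right List.not_mem_nil)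
      · rw [Function.update_of_ne hqw, Function.update_of_ne hqw]
        exact hD q (hq.resolve_left hqw)
    · rcases hl (w :: l₁) l₂ v (by rw [hv]; rfl) q hq with h | h
      · exact Or.inl (Or.inr h)
      · rcases List.mem_cons.1 h with h | h
        · exact Or.inl (Or.inl h)
        · exact Or.inr h
    · rcases hp with h | h
      · exact Or.inl (Or.inr h)
      · rcases List.mem_cons.1 h with h | h
        · exact Or.inl (Or.inl h)
        · exact Or.inr h

namespace Extraction

variable {C : Set H.Vertex} {N : ℕ} (R : H.Extraction C N)

lemma sweepFrom_of_notMem (T : H.Tensor) (s : Summary H.Env R.start.1) {v : H.Vertex}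
    (hv : v ∉ C) : R.sweepFrom T s v = T v := by
  have hne : v ≠ R.start := fun h => hv (h ▸ R.start_mem)
  rw [sweepFrom, forwardSweep, foldl_rule_of_notMem, Function.update_of_ne hne]
  simp [R.mem_order, hv, hne]

lemma sweepFrom_induction (P : ∀ v : H.Vertex, Summary H.Env v.1 → Summary H.Env v.1 → Prop)
    (hP : ∀ (v : H.Vertex) (U U' : H.Tensor), (∀ p, H.Edge p v → P p (U p) (U' p)) →
      P v (H.rule R.post U v.2) (H.rule R.post U' v.2))
    {T T' : H.Tensor} {s s' : Summary H.Env R.start.1} (hT : ∀ v ∉ C, P v (T v) (T' v))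
    (hs : P R.start s s') (v : H.Vertex) : P v (R.sweepFrom T s v) (R.sweepFrom T' s' v) := by
  refine foldl_rule_induction R.post P hP _ (insert R.start Cᶜ) _ _ (fun p hp => ?_)
    (fun l₁ l₂ w hw p hp => ?_) v ?_
  · by_cases h : p = R.start
    · subst h
      rw [Function.update_self, Function.update_self]
      exact hs
    · rw [Function.update_of_ne h, Function.update_of_ne h]
      exact hT p (hp.resolve_left h)
  · by_cases hpC : p ∈ C
    · by_cases hps : p = R.start
      · exact Or.inl (Or.inl hps)
      · refine Or.inr ?_
        rcases List.eq_nil_or_concat l₂ with rfl | ⟨l₃, z, rfl⟩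
        · -- the start vertex itself, visited last
          obtain ⟨rfl, -⟩ := List.append_inj' hw rfl
          exact (R.mem_order p).2 ⟨hpC, hps⟩
        · have hw' : R.order ++ [R.start] = (l₁ ++ w :: l₃) ++ [z] := by simpa using hw
          obtain ⟨ho, -⟩ := List.append_inj' hw' rfl
          exact (R.order_spec l₁ l₃ w ho p hpC hp).resolve_left hps
    · exact Or.inl (Or.inr hpC)
  · by_cases hv : v ∈ C
    · right
      rw [List.mem_append, R.mem_order, List.mem_singleton]
      tauto
    · exact Or.inl (Or.inr hv)

lemma sweepFrom_wellFormed {T : H.Tensor} {s : Summary H.Env R.start.1}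
    (hT : ∀ v ∉ C, (T v).WellFormed) (hs : s.WellFormed) (v : H.Vertex) :
    (R.sweepFrom T s v).WellFormed :=
  R.sweepFrom_induction (fun _ s _ => s.WellFormed)
    (fun v _ _ h => rule_wellFormed R.post v.2 h) (T' := T) (s' := s) hT hs v

lemma sweepFrom_agreeAt {T T' : H.Tensor} {s s' : Summary H.Env R.start.1} {t : ℤ}
    (hT : ∀ v ∉ C, (T v).WellFormed) (hTT' : ∀ v ∉ C, T v = T' v) (hs : s.WellFormed)
    (hs' : s'.WellFormed) (h : AgreeAt t s s') (v : H.Vertex) :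
    AgreeAt t (R.sweepFrom T s v) (R.sweepFrom T' s' v) :=
  (R.sweepFrom_induction (fun _ s s' => s.WellFormed ∧ s'.WellFormed ∧ AgreeAt t s s')
    (fun v _ _ h => ⟨rule_wellFormed R.post v.2 fun p hp => (h p hp).1,
      rule_wellFormed R.post v.2 fun p hp => (h p hp).2.1,
      rule_agreeAt R.post v.2 (fun p hp => (h p hp).1) (fun p hp => (h p hp).2.1)
        fun p hp => (h p hp).2.2⟩)
    (fun v hv => ⟨hT v hv, hTT' v hv ▸ hT v hv, hTT' v hv ▸ AgreeAt.refl _ _⟩)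
    ⟨hs, hs', h⟩ v).2.2

/-- A final branch that applies at the start vertex after a sweep stems from a final branch that
applied there before the sweep, at the same position and with the same element. -/
lemma sweepFrom_final {T : H.Tensor} {s : Summary H.Env R.start.1}
    (hT : ∀ v ∉ C, ∀ θ t x y, ¬ (T v).Yields θ t x false y) {θ : H.Env} {t : ℤ}
    {x : Pos R.start.1} {y : Elem R.start.1}
    (hy : (R.sweepFrom T s R.start).Yields θ t x false y) : s.Yields θ t x false y := by
  -- stated for vertices of all types: a final branch requires the type of the start vertex
  let Q : ∀ σ : Ty, H.Env → ℤ → Pos σ → Elem σ → Prop := fun σ θ t x y =>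
    ∀ h : σ = R.start.1, s.Yields θ t (h ▸ x) false (h ▸ y)
  exact R.sweepFrom_induction
    (fun v s _ => ∀ θ t x y, s.Yields θ t x false y → Q v.1 θ t x y)
    (fun v _ _ h θ t x y => rule_final R.post v.2 Q h) (T' := T) (s' := s)
    (fun v hv θ t x y hy => (hT v hv θ t x y hy).elim) (fun θ t x y hy _ => hy)
    R.start θ t x y hy rfl

/-! ### Convergence -/

/-- The summary of the start vertex from which the `n`-th sweep begins. -/
noncomputable def sweepInput : ℕ → Summary H.Env R.start.1
  | 0 => Summary.initial R.init
  | n + 1 => (R.general (R.state n)).shift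

lemma state_of_notMem (n : ℕ) {v : H.Vertex} (hv : v ∉ C) :
    R.state n v = (R.known v).asKnown := by
  induction n with
  | zero => rw [state, sweepFrom_of_notMem _ _ _ hv, if_neg hv]
  | succ n ih => rw [state, sweepFrom_of_notMem _ _ _ hv, ih]

/-- Every state is the result of a sweep that starts from the state itself outside of `C`. -/
lemma exists_state_eq_sweepFrom (n : ℕ) : ∃ T : H.Tensor,
    (∀ v ∉ C, T v = (R.known v).asKnown) ∧ R.state n = R.sweepFrom T (R.sweepInput n) := by
  cases n with
  | zero => exact ⟨_, fun v hv => if_neg hv, rfl⟩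
  | succ n => exact ⟨R.state n, fun v hv => R.state_of_notMem n hv, rfl⟩

lemma state_wellFormed (n : ℕ) (v : H.Vertex) : (R.state n v).WellFormed := by
  have hk : ∀ v ∉ C, ((R.known v).asKnown).WellFormed :=
    fun v hv => (R.known_wellFormed v hv).asKnown
  induction n generalizing v with
  | zero =>
    exact R.sweepFrom_wellFormed (fun v hv => by rw [if_neg hv]; exact hk v hv)
      (initial_wellFormed _) v
  | succ n ih =>
    exact R.sweepFrom_wellFormed (fun v _ => ih v) ((ih R.start).generalize _).shift v

lemma sweepInput_wellFormed (n : ℕ) : (R.sweepInput n).WellFormed := by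
  cases n with
  | zero => exact initial_wellFormed _
  | succ n => exact ((R.state_wellFormed n R.start).generalize _).shift

lemma state_agreeAt_of_sweepInput {n n' : ℕ} {t : ℤ}
    (h : AgreeAt t (R.sweepInput n) (R.sweepInput n')) (v : H.Vertex) :
    AgreeAt t (R.state n v) (R.state n' v) := by
  obtain ⟨T, hT, hn⟩ := R.exists_state_eq_sweepFrom n
  obtain ⟨T', hT', hn'⟩ := R.exists_state_eq_sweepFrom n'
  rw [hn, hn']
  exact R.sweepFrom_agreeAt (fun v hv => by rw [hT v hv]; exact (R.known_wellFormed v hv).asKnown)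
    (fun v hv => (hT v hv).trans (hT' v hv).symm) (R.sweepInput_wellFormed n)
    (R.sweepInput_wellFormed n') h v

/-- After `n` further sweeps, the iterations `1, …, n + 1` are settled: iteration `1` always starts
from the initial summary, and the summary of iteration `t` only depends on the previous sweep's
summaries of the iterations before `t`. -/
lemma state_agreeAt_succ (n : ℕ) {t : ℤ} (h1 : 1 ≤ t) (ht : t ≤ n + 1) (v : H.Vertex) :
    AgreeAt t (R.state n v) (R.state (n + 1) v) := by
  induction n generalizing t v with
  | zero =>
    refine R.state_agreeAt_of_sweepInput (fun θ x u y => ?_) v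
    simp only [sweepInput, general, shift_yields_iff, initial_yields_iff, generalize_yields_iff]
    have hno : ∀ p : ℤ → Prop, ¬ ∃ t₁, 1 ≤ t₁ ∧ t₁ ≤ t - 1 ∧ p t₁ := by
      rintro p ⟨t₁, h, h', -⟩
      push_cast at ht
      omega
    constructor
    · rintro ⟨hu, hy⟩
      exact Or.inr ⟨hu, hy, hno _⟩
    · rintro (⟨-, h⟩ | ⟨hu, hy, -⟩)
      · exact (hno _ h).elim
      · exact ⟨hu, hy⟩
  | succ n ih =>
    refine R.state_agreeAt_of_sweepInput (fun θ x u y => ?_) v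
    simp only [sweepInput, shift_yields_iff]
    exact AgreeAt.generalize
      (fun t₁ h h' => ih h (by push_cast at ht; omega) R.start) R.init θ x u y

lemma state_agreeAt_of_le {n : ℕ} (hn : N ≤ n) {t : ℤ} (h1 : 1 ≤ t) (ht : t ≤ N)
    (v : H.Vertex) : AgreeAt t (R.state N v) (R.state n v) := by
  induction n, hn using Nat.le_induction with
  | base => exact AgreeAt.refl _ _
  | succ n hn ih => exact ih.trans (R.state_agreeAt_succ n h1 (by omega) v)

/-- Where the final branch applies after iteration `t`, no earlier iteration made an update, since
the sweep has copied the final branch from the shifted generalization. -/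
lemma state_final {n : ℕ} {θ : H.Env} {t : ℤ} {x : Pos R.start.1} {y : Elem R.start.1}
    (hy : (R.state (n + 1) R.start).Yields θ t x false y) :
    y = R.init θ x ∧
      ¬ ∃ t₁, 1 ≤ t₁ ∧ t₁ ≤ t - 1 ∧ ∃ y', (R.state n R.start).Yields θ t₁ x true y' := by
  have h := R.sweepFrom_final (fun v hv θ t x y => by
    rw [R.state_of_notMem n hv]
    simp [Yields, asKnown]) hy
  rw [shift_yields_iff, general, generalize_yields_iff] at h
  simpa using h

/-- Once two consecutive states agree on all iterations, the summary of the start vertex is its own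
generalization. -/
lemma testPasses_succ {n : ℕ} (hn : N ≤ n + 1) : R.TestPasses (n + 1) := by
  refine Equiv.of_agreeAt (R.state_wellFormed _ _) ((R.state_wellFormed _ _).generalize _)
    fun t h1 ht => AgreeAt.of_imp (R.state_wellFormed _ _)
      ((R.state_wellFormed _ _).generalize _) fun θ x u y hy => ?_
  have hy' := (R.state_agreeAt_succ n h1 (by omega) R.start θ x u y).2 hy
  rw [Nat.add_sub_cancel, general, generalize_yields_iff]
  cases u with
  | true =>
    refine Or.inl ⟨rfl, t, h1, le_rfl, hy', ?_⟩
    rintro ⟨t₂, h, h', -⟩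
    omega
  | false =>
    obtain ⟨hinit, hno⟩ := R.state_final hy
    refine Or.inr ⟨rfl, hinit, ?_⟩
    rintro ⟨t₁, h, h', y', hy₁⟩
    rcases h'.lt_or_eq with hlt | rfl
    · exact hno ⟨t₁, h, by omega, y', hy₁⟩
    · exact Bool.false_ne_true ((R.state_wellFormed n R.start).yields_unique hy' hy₁).1

end Extraction

end DepGraph

end StencilLifting

theorem mainTheorem3 {K d m : ℕ} (G : StencilLifting.SMG K) (hG : G.IsStencil d m)
    (k : ℕ) (hk : 1 ≤ k ∧ k ≤ K) (H : StencilLifting.DepGraph) (hH : G.IsInvariantSubgraph k H)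
    (C : Set H.Vertex) (hC : H.IsSCC C) (R : H.Extraction C (G.N k)) :
    ∃ n_iter : ℕ, 1 ≤ n_iter ∧ R.TestPasses n_iter ∧
      ∀ n ≥ n_iter, R.TestPasses n ∧
        ∀ v ∈ C, (R.state n v).Equiv (G.N k) (R.state n_iter v) := by
  have test : ∀ n ≥ G.N k + 1, R.TestPasses n := by
    intro n hn
    obtain ⟨n, rfl⟩ := Nat.exists_eq_succ_of_ne_zero (by omega : n ≠ 0)
    exact R.testPasses_succ (by omega)
  -- `G.N k` sweeps settle all iterations; the witness has to be positive also if `G.N k = 0`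
  refine ⟨G.N k + 1, by omega, test _ le_rfl, fun n hn => ⟨test n hn, fun v _ => ?_⟩⟩
  exact StencilLifting.Summary.Equiv.of_agreeAt (R.state_wellFormed _ _) (R.state_wellFormed _ _)
    fun t h1 ht => (R.state_agreeAt_of_le (by omega) h1 ht v).symm.trans
      (R.state_agreeAt_of_le (by omega) h1 ht v)
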